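/- Let $n\ge 1$. For $m\ge 0$ let $B_m=\mathbb R[x_{ij},y_{ij}]_{1\le i\le m,\,1\le j\le n}$, graded with all variables in degree $1$ and with $S_m$ acting by simultaneous permutation of the pairs $(\mathbf x_i,\mathbf y_i)$. Let $B_{m+1}^{S_{m+1}}\to B_m^{S_m}$ be the map that sets $x_{m+1,j}=y_{m+1,j}=0$ for all $j$, and let $$A_{fin}[Sp^\infty(\mathbb A^1_n)]=\varprojlim_m B_m^{S_m}$$ be the inverse limit in the category of graded rings, i.e. the ring of compatible sequences $f=(f_m)_m$ of multisymmetric polynomials whose degrees are bounded. Let $Sp^\infty(\mathbb R^n\times\mathbb R^n)$ be the set of finite multisets of points $(\mathbf x,\mathbf y)\in\mathbb R^n\times\mathbb R^n$ modulo adding copies of the base point $(\mathbf 0,\mathbf 0)$; for $X\in Sp^\infty(\mathbb R^n\times\mathbb R^n)$ represented by $\{(\mathbf x_1,\mathbf y_1),\dots,(\mathbf x_m,\mathbf y_m)\}$ put $\varphi_X(f)=f_m(\mathbf x_1,\mathbf y_1,\dots,\mathbf x_m,\mathbf y_m)$. Let $\widetilde{Sp}(\mathbb R^n\times\mathbb R^n)$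 be the set of finite multisets of points of $\mathbb R^n\times\mathbb R^n$ modulo the equivalence relation generated by removing an element $(\mathbf z,\mathbf z')$ with $z_k=z'_k$ for some $k$ (a "cube of volume zero"). Define $A_{fin}[\widetilde{Sp}(\mathbb A^1_n)]$ to be the ring of all $f\in A_{fin}[Sp^\infty(\mathbb A^1_n)]$ such that $\varphi_{X_1}(f)=\varphi_{X_2}(f)$ whenever $X_1,X_2\in Sp^\infty(\mathbb R^n\times\mathbb R^n)$ have the same image in $\widetilde{Sp}(\mathbb R^n\times\mathbb R^n)$. Put $\eta_{ij}=y_{ij}-x_{ij}$ and $\xi_{ij}=y_{ij}+x_{ij}$. Then $A_{fin}[\widetilde{Sp}(\mathbb A^1_n)]$ is freely generated as an $\mathbb R$-algebra by the infinite multisymmetric power sums $$p_{\mathbf a,\mathbf b}=\sum_{i=1}^\infty \eta_{i1}^{a_1}\cdots\eta_{in}^{a_n}\,\xi_{i1}^{b_1}\cdots\xi_{in}^{b_n},\qquad \mathbf a,\mathbf b\in\mathbb N^n,\quad a_j\ge 1\text{ for all }j,$$ where $p_{\mathbf a,\mathbf b}$ denotes the compatible sequence of its truncations $\sum_{i=1}^m$.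 That is, these $p_{\mathbf a,\mathbf b}$ are algebraically independent over $\mathbb R$ and generate $A_{fin}[\widetilde{Sp}(\mathbb A^1_n)]$ as an $\mathbb R$-algebra. -/

import Mathlib

namespace PersistentCubes

noncomputable section

open MvPolynomial

/-- The polynomial ring `ℝ[x_{ij}, y_{ij}]`, `1 ≤ i ≤ m`, `1 ≤ j ≤ n`, the coordinate ring of
`m`-tuples of points `(𝐱_i, 𝐲_i)` of `ℝⁿ × ℝⁿ`; all variables have degree one. The index
`(i, Sum.inl j)` stands for `x_{ij}` and `(i, Sum.inr j)` for `y_{ij}`. -/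
abbrev CoordRing (n m : ℕ) : Type := MvPolynomial (Fin m × (Fin n ⊕ Fin n)) ℝ

/-- The action of a permutation of the `m` points on the coordinate ring. -/
def permAct {n m : ℕ} (σ : Equiv.Perm (Fin m)) : CoordRing n m →ₐ[ℝ] CoordRing n m :=
  rename (Prod.map σ id)

/-- `A[Sp^m]`: the multisymmetric polynomials, i.e. the invariants of the simultaneous
permutations of the `(𝐱_i, 𝐲_i)`. -/
def symRing (n m : ℕ) : Subalgebra ℝ (CoordRing n m) where
  carrier := {f | ∀ σ : Equiv.Perm (Fin m), permAct σ f = f}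
  mul_mem' hf hg σ := by rw [map_mul, hf σ, hg σ]
  add_mem' hf hg σ := by rw [map_add, hf σ, hg σ]
  algebraMap_mem' r σ := AlgHom.commutes _ r

/-- The restriction `A[Sp^{m+1}] → A[Sp^m]` dual to adding the base point `(0, 0)` (on all of the
coordinate ring): the variables of the last point are set to zero. -/
def restrict (n m : ℕ) : CoordRing n (m + 1) →ₐ[ℝ] CoordRing n m :=
  aeval fun p => Fin.lastCases (motive := fun _ => CoordRing n m) 0 (fun i => X (i, p.2)) p.1

/-- `A[Sp^∞]`, the inverse limit of the rings `A[Sp^m]`: compatible sequences of multisymmetric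
polynomials. -/
def limRing (n : ℕ) : Subalgebra ℝ (∀ m, CoordRing n m) where
  carrier := {f | (∀ m, f m ∈ symRing n m) ∧ ∀ m, restrict n m (f (m + 1)) = f m}
  mul_mem' hf hg :=
    ⟨fun m => mul_mem (hf.1 m) (hg.1 m), fun m => by
      simp only [Pi.mul_apply, map_mul, hf.2 m, hg.2 m]⟩
  add_mem' hf hg :=
    ⟨fun m => add_mem (hf.1 m) (hg.1 m), fun m => by
      simp only [Pi.add_apply, map_add, hf.2 m, hg.2 m]⟩
  algebraMap_mem' r :=
    ⟨fun m => (symRing n m).algebraMap_mem r, fun m => AlgHom.commutes (restrict n m) r⟩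

/-- `A_fin[Sp^∞]`, the `K`-finite functions: the inverse limit of the `A[Sp^m]` in the category of
graded rings, i.e. the compatible sequences of bounded degree. (See `toSubmodule_finRing`: these
are the finite sums of compatible sequences that are homogeneous of a fixed degree.) -/
def finRing (n : ℕ) : Subalgebra ℝ (∀ m, CoordRing n m) where
  carrier := {f | f ∈ limRing n ∧ ∃ D : ℕ, ∀ m, (f m).totalDegree ≤ D}
  mul_mem' := by
    rintro f g ⟨hf, D, hD⟩ ⟨hg, E, hE⟩
    exact ⟨mul_mem hf hg, D + E, fun m =>
      (totalDegree_mul _ _).trans (Nat.add_le_add (hD m) (hE m))⟩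
  add_mem' := by
    rintro f g ⟨hf, D, hD⟩ ⟨hg, E, hE⟩
    exact ⟨add_mem hf hg, max D E, fun m =>
      (totalDegree_add _ _).trans (max_le_max (hD m) (hE m))⟩
  algebraMap_mem' r :=
    ⟨(limRing n).algebraMap_mem r, 0, fun m => (totalDegree_C (R := ℝ) r).le⟩

/-- The degree `d` part of the inverse limit: the inverse limit of the degree `d` parts of the
rings `A[Sp^m]`. -/
def gradedPiece (n d : ℕ) : Submodule ℝ (∀ m, CoordRing n m) where
  carrier := {f | f ∈ limRing n ∧ ∀ m, (f m).IsHomogeneous d}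
  add_mem' hf hg := ⟨add_mem hf.1 hg.1, fun m => (hf.2 m).add (hg.2 m)⟩
  zero_mem' := ⟨zero_mem _, fun _ => isHomogeneous_zero _ _ _⟩
  smul_mem' c _ hf := ⟨(limRing n).smul_mem hf.1 c, fun m =>
    (homogeneousSubmodule _ ℝ d).smul_mem c (hf.2 m)⟩

theorem homogeneousComponent_map {σ τ : Type*}
    (φ : MvPolynomial σ ℝ →ₐ[ℝ] MvPolynomial τ ℝ)
    (hφ : ∀ (p : MvPolynomial σ ℝ) (e : ℕ), p.IsHomogeneous e → (φ p).IsHomogeneous e)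
    (d : ℕ) (p : MvPolynomial σ ℝ) :
    φ (homogeneousComponent d p) = homogeneousComponent d (φ p) := by
  conv_rhs => rw [← sum_homogeneousComponent p]
  rw [map_sum, map_sum]
  have h : ∀ i, homogeneousComponent d (φ (homogeneousComponent i p)) =
      if i = d then φ (homogeneousComponent i p) else 0 := fun i => by
    rw [homogeneousComponent_of_mem (hφ _ i (homogeneousComponent_isHomogeneous i p))]
    simp only [eq_comm]
  simp only [h, Finset.sum_ite_eq', Finset.mem_range]
  split_ifs with hd
  · rfl
  · rw [homogeneousComponent_eq_zero _ _ (by omega), map_zero]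

theorem permAct_isHomogeneous {n m : ℕ} (σ : Equiv.Perm (Fin m)) (p : CoordRing n m) (e : ℕ)
    (hp : p.IsHomogeneous e) : (permAct σ p).IsHomogeneous e :=
  hp.rename_isHomogeneous

theorem restrict_isHomogeneous {n m : ℕ} (p : CoordRing n (m + 1)) (e : ℕ)
    (hp : p.IsHomogeneous e) : (restrict n m p).IsHomogeneous e := by
  have := hp.aeval (n := 1) (fun p : Fin (m + 1) × (Fin n ⊕ Fin n) =>
    Fin.lastCases (motive := fun _ => CoordRing n m) 0 (fun i => X (i, p.2)) p.1) ?_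
  · simpa [restrict] using this
  · rintro ⟨i, v⟩
    refine Fin.lastCases ?_ (fun i => ?_) i
    · simpa using isHomogeneous_zero _ _ _
    · simpa using isHomogeneous_X _ _

/-- `A_fin[Sp^∞]` is the sum, over all degrees `d`, of the inverse limits of the degree `d` parts
of the `A[Sp^m]`, that is, it is the inverse limit in graded rings with the grading forgotten. -/
theorem toSubmodule_finRing (n : ℕ) :
    Subalgebra.toSubmodule (finRing n) = ⨆ d, gradedPiece n d := by
  apply le_antisymm
  · rintro f ⟨hf, D, hD⟩
    have key : f = ∑ d ∈ Finset.range (D + 1), fun m => homogeneousComponent d (f m) := by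
      funext m
      rw [Finset.sum_apply]
      conv_lhs => rw [← sum_homogeneousComponent (f m)]
      refine Finset.sum_subset (Finset.range_mono (Nat.succ_le_succ (hD m))) fun d _ hd => ?_
      exact homogeneousComponent_eq_zero _ _ (by simpa [Nat.lt_succ_iff] using hd)
    rw [key]
    refine Submodule.sum_mem _ fun d _ => Submodule.mem_iSup_of_mem d
      ⟨⟨fun m σ => ?_, fun m => ?_⟩, fun m => homogeneousComponent_isHomogeneous d (f m)⟩
    · rw [homogeneousComponent_map _ (permAct_isHomogeneous σ), hf.1 m σ]
    · rw [homogeneousComponent_map _ restrict_isHomogeneous, hf.2 m]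
  · exact iSup_le fun d f hf => ⟨hf.1, d, fun m => (hf.2 m).totalDegree_le⟩

/-- A point `(𝐱, 𝐲)` of `ℝⁿ × ℝⁿ`, thought of as a pair of opposite vertices of a cube. -/
abbrev Cube (n : ℕ) : Type := (Fin n → ℝ) × (Fin n → ℝ)

/-- A cube has volume zero if some coordinate of `𝐱` equals the same coordinate of `𝐲`. -/
def Cube.IsDegenerate {n : ℕ} (z : Cube n) : Prop := ∃ k, z.1 k = z.2 k

/-- Finite tuples of points of `ℝⁿ × ℝⁿ`, of any length. -/
abbrev CubeTuple (n : ℕ) : Type := Σ m : ℕ, (Fin m → Cube n)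

/-- The identifications that define `Sp^∞(ℝⁿ × ℝⁿ)`: the order of the points does not matter, and
the base point `(0, 0)` may be added. -/
inductive SpInfRel (n : ℕ) : CubeTuple n → CubeTuple n → Prop
  | perm (m : ℕ) (P : Fin m → Cube n) (σ : Equiv.Perm (Fin m)) :
      SpInfRel n ⟨m, P⟩ ⟨m, P ∘ σ⟩
  | base (m : ℕ) (P : Fin m → Cube n) :
      SpInfRel n ⟨m, P⟩ ⟨m + 1, Fin.snoc P (0 : Cube n)⟩

/-- The infinite symmetric product `Sp^∞(ℝⁿ × ℝⁿ)` with base point `(0, 0)`. -/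
def SpInf (n : ℕ) : Type := Quot (SpInfRel n)

/-- The identifications that define `S̃p(ℝⁿ × ℝⁿ)`: the order of the points does not matter, and
any cube of volume zero may be dropped. -/
inductive SpTildeRel (n : ℕ) : CubeTuple n → CubeTuple n → Prop
  | perm (m : ℕ) (P : Fin m → Cube n) (σ : Equiv.Perm (Fin m)) :
      SpTildeRel n ⟨m, P⟩ ⟨m, P ∘ σ⟩
  | drop (m : ℕ) (P : Fin m → Cube n) (z : Cube n) (hz : z.IsDegenerate) :
      SpTildeRel n ⟨m + 1, Fin.snoc P z⟩ ⟨m, P⟩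

/-- `S̃p(ℝⁿ × ℝⁿ)`, the finite multisets of cubes with zero-volume cubes disregarded. -/
def SpTilde (n : ℕ) : Type := Quot (SpTildeRel n)

/-- The quotient map `Sp^∞(ℝⁿ × ℝⁿ) → S̃p(ℝⁿ × ℝⁿ)`; for `n ≥ 1` the base point is a cube of
volume zero. -/
def SpInf.toTilde {n : ℕ} [NeZero n] : SpInf n → SpTilde n :=
  Quot.lift (fun P => Quot.mk _ P) (by
    rintro _ _ (⟨m, P, σ⟩ | ⟨m, P⟩)
    · exact Quot.sound (SpTildeRel.perm m P σ)
    · exact (Quot.sound (SpTildeRel.drop m P 0 ⟨0, rfl⟩)).symm)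

/-- The coordinates of an `m`-tuple of points: the values of the variables `x_{ij}`, `y_{ij}`. -/
def coords {n m : ℕ} (P : Fin m → Cube n) : Fin m × (Fin n ⊕ Fin n) → ℝ :=
  fun p => Sum.elim (P p.1).1 (P p.1).2 p.2

theorem eval_coords_perm {n m : ℕ} (P : Fin m → Cube n) (σ : Equiv.Perm (Fin m))
    (f : CoordRing n m) : eval (coords (P ∘ σ)) f = eval (coords P) (permAct σ f) := by
  rw [permAct, eval_rename]
  rfl

theorem eval_coords_snoc {n m : ℕ} (P : Fin m → Cube n) (f : CoordRing n (m + 1)) :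
    eval (coords (Fin.snoc P (0 : Cube n) : Fin (m + 1) → Cube n)) f =
      eval (coords P) (restrict n m f) := by
  have h : (aeval (coords (Fin.snoc P (0 : Cube n) : Fin (m + 1) → Cube n)) :
      CoordRing n (m + 1) →ₐ[ℝ] ℝ) = (aeval (coords P)).comp (restrict n m) := by
    ext ⟨i, v⟩
    refine Fin.lastCases ?_ (fun i => ?_) i
    · cases v <;> simp [coords, restrict]
    · cases v <;> simp [coords, restrict]
  exact DFunLike.congr_fun h f

/-- `φ_X : A[Sp^∞] → ℝ`, evaluation at `X ∈ Sp^∞(ℝⁿ × ℝⁿ)`: if `X` is represented by an `m`-tuple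
of points, evaluate the `m`-th term of the sequence at this tuple. -/
def evalAt {n : ℕ} (X : SpInf n) : limRing n →ₐ[ℝ] ℝ :=
  Quot.lift
    (fun P : CubeTuple n => ((aeval (coords P.2)).comp
      ((Pi.evalAlgHom ℝ (CoordRing n) P.1).comp (limRing n).val) : limRing n →ₐ[ℝ] ℝ))
    (by
      rintro _ _ (⟨m, P, σ⟩ | ⟨m, P⟩)
      · ext f
        change eval (coords P) (f.1 m) = eval (coords (P ∘ σ)) (f.1 m)
        rw [eval_coords_perm, f.2.1 m σ]
      · ext f
        change eval (coords P) (f.1 m) = eval (coords (Fin.snoc P 0)) (f.1 (m + 1))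
        rw [eval_coords_snoc, f.2.2 m]) X

/-- `A_fin[S̃p]`: the `K`-finite functions `f` such that `φ_{X₁}(f) = φ_{X₂}(f)` whenever
`X₁, X₂ ∈ Sp^∞(ℝⁿ × ℝⁿ)` are identified in `S̃p(ℝⁿ × ℝⁿ)`. -/
def finTildeRing (n : ℕ) [NeZero n] : Subalgebra ℝ (∀ m, CoordRing n m) where
  carrier := {f | ∃ hf : f ∈ finRing n, ∀ X₁ X₂ : SpInf n, X₁.toTilde = X₂.toTilde →
    evalAt X₁ ⟨f, hf.1⟩ = evalAt X₂ ⟨f, hf.1⟩}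
  mul_mem' := by
    rintro f g ⟨hf, hf'⟩ ⟨hg, hg'⟩
    refine ⟨mul_mem hf hg, fun X₁ X₂ h => ?_⟩
    have e : (⟨f * g, (mul_mem hf hg : f * g ∈ finRing n).1⟩ : limRing n) =
      ⟨f, hf.1⟩ * ⟨g, hg.1⟩ := rfl
    rw [e, map_mul, map_mul, hf' X₁ X₂ h, hg' X₁ X₂ h]
  add_mem' := by
    rintro f g ⟨hf, hf'⟩ ⟨hg, hg'⟩
    refine ⟨add_mem hf hg, fun X₁ X₂ h => ?_⟩
    have e : (⟨f + g, (add_mem hf hg : f + g ∈ finRing n).1⟩ : limRing n) =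
      ⟨f, hf.1⟩ + ⟨g, hg.1⟩ := rfl
    rw [e, map_add, map_add, hf' X₁ X₂ h, hg' X₁ X₂ h]
  algebraMap_mem' r :=
    ⟨(finRing n).algebraMap_mem r, fun X₁ X₂ _ =>
      ((evalAt X₁).commutes r).trans ((evalAt X₂).commutes r).symm⟩

/-- The variable `η_{ij} = y_{ij} - x_{ij}`. -/
def eta {n m : ℕ} (i : Fin m) (j : Fin n) : CoordRing n m :=
  X (i, Sum.inr j) - X (i, Sum.inl j)

/-- The variable `ξ_{ij} = y_{ij} + x_{ij}`. -/
def xi {n m : ℕ} (i : Fin m) (j : Fin n) : CoordRing n m :=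
  X (i, Sum.inr j) + X (i, Sum.inl j)

/-- The infinite multisymmetric power sum
`p_{𝐚,𝐛} = ∑_i η_{i1}^{a_1} ⋯ η_{in}^{a_n} ξ_{i1}^{b_1} ⋯ ξ_{in}^{b_n}`, as the sequence of its
truncations to the first `m` points. -/
def powerSum {n : ℕ} (a b : Fin n → ℕ) : ∀ m, CoordRing n m :=
  fun _ => ∑ i, (∏ j, eta i j ^ a j) * ∏ j, xi i j ^ b j

end

end PersistentCubes

namespace PersistentCubes

noncomputable section

open MvPolynomial

/-! The values of all power sums at a finite tuple of points form the sum of the vectors of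
monomials `v(z)` at these points. Tuples of points thus trace out the additive monoid generated by
the `v(z)`. A polynomial vanishing on this monoid vanishes on its linear span, since ℕ^k is Zariski
dense in ℝ^k. As distinct monomials are linearly independent, the span fills every finite set of
coordinates. This gives algebraic independence.

For generation, write an invariant element as `F(p)` with `F` a polynomial in all power sums; this
is possible by averaging over permutations, a Newton-type recursion with degree control, and
injectivity of restriction in low degree. Adding degenerate cubes translates the value vector `w` by
an element of the monoid generated by the `v(z)` with some `η_j = 0`, and `F` does not change. It
therefore does not change under the span of these `v(z)` either. On finitely many coordinates, this
span contains every basis vector indexed by a monomial free of some `η_j`. Translating these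
coordinates of `w` to zero removes the unwanted power sums from `F`
(`aeval_powerSum_eq_of_mem_finTildeRing`). -/

/-! ### Zariski density of sums of monomial vectors -/

/-- A polynomial that vanishes on the additive monoid generated by a set of vectors vanishes on the
linear span of this set. -/
theorem eval_eq_zero_of_mem_span {ι : Type*} {V : Set (ι → ℝ)} {F : MvPolynomial ι ℝ}
    (h : ∀ u ∈ AddSubmonoid.closure V, eval u F = 0) {u : ι → ℝ}
    (hu : u ∈ Submodule.span ℝ V) : eval u F = 0 := by
  obtain ⟨k, t, g, rfl⟩ := Submodule.mem_span_set'.1 hu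
  have key : ∀ t : Fin k → ℝ, eval t (aeval (fun i => ∑ l, C ((g l : ι → ℝ) i) * X l) F :
      MvPolynomial (Fin k) ℝ) = eval (∑ l, t l • (g l : ι → ℝ)) F := fun t => by
    rw [← aeval_eq_eval, ← aeval_eq_eval, comp_aeval_apply]
    congr 2
    funext i
    simp [Finset.sum_apply, mul_comm]
  -- As a polynomial in the coefficients `t`, this vanishes on ℕ^k, because natural combinations of
  -- the generators lie in the monoid.
  have hG : (aeval (fun i => ∑ l, C ((g l : ι → ℝ) i) * X l) F :
      MvPolynomial (Fin k) ℝ) = 0 := by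
    refine funext_set (fun _ => Set.range ((↑) : ℕ → ℝ))
      (fun _ => Set.infinite_range_of_injective Nat.cast_injective) fun x hx => ?_
    choose a ha using fun i => hx i trivial
    rw [map_zero, key]
    refine h _ (sum_mem fun l _ => ?_)
    rw [← ha l, Nat.cast_smul_eq_nsmul]
    exact nsmul_mem (AddSubmonoid.subset_closure (g l).2) _
  rw [← key, hG, map_zero]

/-- The values at a point `z` of the monomials with exponents `c i`. -/
def monomialVector {ι σ : Type*} [Fintype σ] (c : ι → σ → ℕ) (z : σ → ℝ) : ι → ℝ :=
  fun i => ∏ s, z s ^ c i s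

/-- On the coordinate subspace cut out by `K`, the monomials involving `K` vanish and the others
remain linearly independent. -/
theorem exists_monomialVector_dual_ne_zero {ι σ : Type*} [Fintype σ] [Fintype ι]
    {c : ι → σ → ℕ} (hc : Function.Injective c) {K : Set σ} {i : ι} (hi : ∀ s ∈ K, c i s = 0)
    (l : ι → ℝ) (hl : l i ≠ 0) :
    ∃ z : σ → ℝ, (∀ s ∈ K, z s = 0) ∧ ∑ j, l j * monomialVector c z j ≠ 0 := by
  classical
  by_contra! hcon
  let p : MvPolynomial σ ℝ := ∑ j ∈ Finset.univ.filter (fun j => ∀ s ∈ K, c j s = 0),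
    monomial (Finsupp.equivFunOnFinite.symm (c j)) (l j)
  have hp : p = 0 := by
    refine MvPolynomial.funext fun z => ?_
    have h := hcon (fun s => if s ∈ K then 0 else z s) (fun s hs => by simp [hs])
    rw [map_zero, ← h, map_sum, Finset.sum_filter]
    refine Finset.sum_congr rfl fun j _ => ?_
    split_ifs with hj
    · rw [eval_monomial, Finsupp.prod_fintype _ _ (by simp)]
      congr 1
      refine Finset.prod_congr rfl fun s _ => ?_
      by_cases hs : s ∈ K
      · simp [hs, hj s hs]
      · simp [hs]
    · push Not at hj
      obtain ⟨s, hs, hne⟩ := hj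
      symm
      rw [monomialVector, Finset.prod_eq_zero (Finset.mem_univ s) (by simp [hs, hne]), mul_zero]
  have hcoeff : coeff (Finsupp.equivFunOnFinite.symm (c i)) p = l i := by
    simp only [p, coeff_sum, coeff_monomial, EmbeddingLike.apply_eq_iff_eq, hc.eq_iff]
    rw [Finset.sum_ite_eq_of_mem' _ _ _ (by simpa using hi)]
  rw [hp, coeff_zero] at hcoeff
  exact hl hcoeff.symm

/-- By duality: if a basis vector in the support of `u` were outside the span restricted to `S`, a
functional would kill the span but not that vector, contrary to the previous lemma. For infinite `ι`
the vector `u` itself need not lie in the span. -/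
theorem exists_mem_span_monomialVector {ι σ : Type*} [Fintype σ]
    {c : ι → σ → ℕ} (hc : Function.Injective c) {Z : Set (σ → ℝ)} {u : ι → ℝ}
    (hu : ∀ i, u i ≠ 0 → ∃ K : Set σ, (∀ s ∈ K, c i s = 0) ∧ ∀ z, (∀ s ∈ K, z s = 0) → z ∈ Z)
    (S : Finset ι) :
    ∃ u' ∈ Submodule.span ℝ (monomialVector c '' Z), ∀ i ∈ S, u' i = u i := by
  classical
  let r : (ι → ℝ) →ₗ[ℝ] (S → ℝ) := LinearMap.funLeft ℝ ℝ Subtype.val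
  suffices h : r u ∈ (Submodule.span ℝ (monomialVector c '' Z)).map r by
    obtain ⟨u', hu', h⟩ := h
    exact ⟨u', hu', fun i hi => congrFun h ⟨i, hi⟩⟩
  have e : r u = ∑ i : S, u i • Pi.single i (1 : ℝ) := by
    funext i
    simp [r, LinearMap.funLeft_apply, Finset.sum_apply, Pi.single_apply]
  rw [e]
  refine sum_mem fun i _ => ?_
  by_cases h0 : u i = 0
  · simp [h0]
  refine Submodule.smul_mem _ _ ?_
  obtain ⟨K, hK, hKZ⟩ := hu i h0
  by_contra hnot
  obtain ⟨φ, hφ, hle⟩ := Submodule.exists_le_ker_of_notMem hnot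
  obtain ⟨z, hz, hne⟩ := exists_monomialVector_dual_ne_zero (c := fun j : S => c j)
    (hc.comp Subtype.val_injective) hK (fun j => φ (Pi.single j 1)) hφ
  refine hne ?_
  have hmem : r (monomialVector c z) ∈ LinearMap.ker φ :=
    hle (Submodule.mem_map_of_mem (Submodule.subset_span ⟨z, hKZ z hz, rfl⟩))
  rw [LinearMap.mem_ker, LinearMap.pi_apply_eq_sum_univ φ] at hmem
  rw [← hmem]
  refine Finset.sum_congr rfl fun j _ => ?_
  rw [smul_eq_mul, mul_comm]
  have hs : (Pi.single j 1 : S → ℝ) = fun k => if j = k then 1 else 0 := by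
    funext k
    simp [Pi.single_apply, eq_comm]
  rw [hs]
  rfl

/-- A polynomial in the monomials `c i` that vanishes on all sums of vectors of monomials at points
of `Z` vanishes at each vector supported on the monomials which are not identically zero on some
coordinate subspace contained in `Z`. -/
theorem eval_eq_zero_of_monomialVector {ι σ : Type*} [Fintype σ]
    {c : ι → σ → ℕ} (hc : Function.Injective c) {Z : Set (σ → ℝ)} {F : MvPolynomial ι ℝ}
    (h : ∀ u ∈ AddSubmonoid.closure (monomialVector c '' Z), eval u F = 0) {u : ι → ℝ}
    (hu : ∀ i, u i ≠ 0 → ∃ K : Set σ, (∀ s ∈ K, c i s = 0) ∧ ∀ z, (∀ s ∈ K, z s = 0) → z ∈ Z) :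
    eval u F = 0 := by
  -- Only the finitely many variables of `F` matter.
  obtain ⟨u', hu', e⟩ := exists_mem_span_monomialVector hc hu F.vars
  rw [← eval_eq_zero_of_mem_span h hu']
  exact eval₂Hom_congr' rfl (fun i hi _ => (e i hi).symm) rfl

/-! ### Power sums as compatible sequences -/

@[simp] theorem permAct_eta {n m : ℕ} (σ : Equiv.Perm (Fin m)) (i : Fin m) (j : Fin n) :
    permAct σ (eta i j) = eta (σ i) j := by
  simp [permAct, eta]

@[simp] theorem permAct_xi {n m : ℕ} (σ : Equiv.Perm (Fin m)) (i : Fin m) (j : Fin n) :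
    permAct σ (xi i j) = xi (σ i) j := by
  simp [permAct, xi]

@[simp] theorem restrict_eta_castSucc {n m : ℕ} (i : Fin m) (j : Fin n) :
    restrict n m (eta i.castSucc j) = eta i j := by
  simp [restrict, eta]

@[simp] theorem restrict_xi_castSucc {n m : ℕ} (i : Fin m) (j : Fin n) :
    restrict n m (xi i.castSucc j) = xi i j := by
  simp [restrict, xi]

@[simp] theorem restrict_eta_last {n m : ℕ} (j : Fin n) :
    restrict n m (eta (Fin.last m) j) = 0 := by
  simp [restrict, eta]

@[simp] theorem restrict_xi_last {n m : ℕ} (j : Fin n) :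
    restrict n m (xi (Fin.last m) j) = 0 := by
  simp [restrict, xi]

theorem prod_zero_pow_mul_prod_zero_pow {R : Type*} [CommRing R] {n : ℕ}
    {c : (Fin n → ℕ) × (Fin n → ℕ)} (hc : c ≠ 0) :
    (∏ j, (0 : R) ^ c.1 j) * ∏ j, (0 : R) ^ c.2 j = 0 := by
  by_cases h : c.1 = 0
  · have h2 : c.2 ≠ 0 := fun h2 => hc (Prod.ext h h2)
    obtain ⟨j, hj⟩ := Function.ne_iff.1 h2
    rw [Finset.prod_eq_zero (f := fun j => (0 : R) ^ c.2 j) (Finset.mem_univ j) (zero_pow hj),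
      mul_zero]
  · obtain ⟨j, hj⟩ := Function.ne_iff.1 h
    rw [Finset.prod_eq_zero (f := fun j => (0 : R) ^ c.1 j) (Finset.mem_univ j) (zero_pow hj),
      zero_mul]

theorem totalDegree_eta_le {n m : ℕ} (i : Fin m) (j : Fin n) :
    (eta i j : CoordRing n m).totalDegree ≤ 1 :=
  (totalDegree_sub _ _).trans (by simp)

theorem totalDegree_xi_le {n m : ℕ} (i : Fin m) (j : Fin n) :
    (xi i j : CoordRing n m).totalDegree ≤ 1 :=
  (totalDegree_add _ _).trans (by simp)

theorem totalDegree_prod_pow_le {σ ι : Type*} (s : Finset ι) (f : ι → MvPolynomial σ ℝ)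
    (hf : ∀ i, (f i).totalDegree ≤ 1) (a : ι → ℕ) :
    (∏ i ∈ s, f i ^ a i).totalDegree ≤ ∑ i ∈ s, a i :=
  (totalDegree_finsetProd _ _).trans (Finset.sum_le_sum fun i _ =>
    (totalDegree_pow _ _).trans (by simpa using Nat.mul_le_mul_left (a i) (hf i)))

theorem totalDegree_powerSum_le {n : ℕ} (a b : Fin n → ℕ) (m : ℕ) :
    (powerSum a b m).totalDegree ≤ ∑ j, a j + ∑ j, b j :=
  totalDegree_finsetSum_le fun i _ => (totalDegree_mul _ _).trans
    (Nat.add_le_add (totalDegree_prod_pow_le _ _ (totalDegree_eta_le i) a)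
      (totalDegree_prod_pow_le _ _ (totalDegree_xi_le i) b))

theorem powerSum_mem_finRing {n : ℕ} {c : (Fin n → ℕ) × (Fin n → ℕ)} (hc : c ≠ 0) :
    powerSum c.1 c.2 ∈ finRing n := by
  refine ⟨⟨fun m σ => ?_, fun m => ?_⟩, _, totalDegree_powerSum_le c.1 c.2⟩
  · simp only [powerSum, map_sum, map_mul, map_prod, map_pow, permAct_eta, permAct_xi]
    exact Equiv.sum_comp σ fun i => (∏ j, eta i j ^ c.1 j) * ∏ j, xi i j ^ c.2 j
  · simp only [powerSum, Fin.sum_univ_castSucc, map_add, map_sum, map_mul, map_prod, map_pow,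
      restrict_eta_castSucc, restrict_xi_castSucc, restrict_eta_last, restrict_xi_last,
      prod_zero_pow_mul_prod_zero_pow hc, add_zero]

/-! ### Generation of `finRing` by power sums -/

/-- The algebra generated by all compatible power sums. -/
def powerSumRing (n : ℕ) : Subalgebra ℝ (∀ m, CoordRing n m) :=
  Algebra.adjoin ℝ (Set.range fun c : {c : (Fin n → ℕ) × (Fin n → ℕ) // c ≠ 0} =>
    powerSum c.1.1 c.1.2)

theorem powerSumRing_le_finRing (n : ℕ) : powerSumRing n ≤ finRing n :=
  Algebra.adjoin_le (by rintro _ ⟨c, rfl⟩; exact powerSum_mem_finRing c.2)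

/-- The polynomials in `D` points that extend to elements of `powerSumRing n` of degree at most
`d`. -/
def extendable (n D d : ℕ) : Submodule ℝ (CoordRing n D) where
  carrier := {g | ∃ F ∈ powerSumRing n, F D = g ∧ ∀ m, (F m).totalDegree ≤ d}
  add_mem' := by
    rintro _ _ ⟨F, hF, rfl, hFd⟩ ⟨G, hG, rfl, hGd⟩
    exact ⟨F + G, add_mem hF hG, rfl, fun m =>
      (totalDegree_add _ _).trans (max_le (hFd m) (hGd m))⟩
  zero_mem' := ⟨0, zero_mem _, rfl, fun m => by simp⟩
  smul_mem' := by
    rintro r _ ⟨F, hF, rfl, hFd⟩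
    exact ⟨r • F, Subalgebra.smul_mem _ hF r, rfl, fun m =>
      (totalDegree_smul_le _ _).trans (hFd m)⟩

theorem one_mem_extendable (n D : ℕ) : 1 ∈ extendable n D 0 :=
  ⟨1, one_mem _, rfl, fun m => by simp⟩

theorem mul_mem_extendable {n D d e : ℕ} {g h : CoordRing n D} (hg : g ∈ extendable n D d)
    (hh : h ∈ extendable n D e) : g * h ∈ extendable n D (d + e) := by
  obtain ⟨F, hF, rfl, hFd⟩ := hg
  obtain ⟨G, hG, rfl, hGd⟩ := hh
  exact ⟨F * G, mul_mem hF hG, rfl, fun m =>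
    (totalDegree_mul _ _).trans (Nat.add_le_add (hFd m) (hGd m))⟩

theorem extendable_mono {n D d e : ℕ} (h : d ≤ e) : extendable n D d ≤ extendable n D e := by
  rintro _ ⟨F, hF, rfl, hFd⟩
  exact ⟨F, hF, rfl, fun m => (hFd m).trans h⟩

theorem powerSum_mem_extendable {n D : ℕ} (a b : Fin n → ℕ) :
    powerSum a b D ∈ extendable n D (∑ j, a j + ∑ j, b j) := by
  by_cases hc : (a, b) = 0
  -- With all exponents zero the truncations `m` are not compatible, but the value `D` extends as a
  -- constant.
  · obtain ⟨rfl, rfl⟩ := Prod.mk_eq_zero.1 hc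
    have h : powerSum (0 : Fin n → ℕ) 0 D = (D : ℝ) • (1 : CoordRing n D) := by
      simp [powerSum, Algebra.smul_def]
    rw [h]
    exact Submodule.smul_mem _ _ (extendable_mono (Nat.zero_le _) (one_mem_extendable n D))
  · exact ⟨powerSum a b, Algebra.subset_adjoin ⟨⟨(a, b), hc⟩, rfl⟩, rfl, totalDegree_powerSum_le a b⟩

/-- A polynomial function of one point, as a function of the `i`-th of `m` points. -/
def atPoint {n m : ℕ} (i : Fin m) :
    MvPolynomial (Fin n ⊕ Fin n) ℝ →ₐ[ℝ] CoordRing n m :=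
  rename (Prod.mk i)

theorem permAct_atPoint {n m : ℕ} (σ : Equiv.Perm (Fin m)) (i : Fin m)
    (q : MvPolynomial (Fin n ⊕ Fin n) ℝ) : permAct σ (atPoint i q) = atPoint (σ i) q := by
  rw [permAct, atPoint, atPoint, rename_rename]
  rfl

theorem totalDegree_aeval_le {σ τ : Type*} (g : σ → MvPolynomial τ ℝ)
    (hg : ∀ i, (g i).totalDegree ≤ 1) (p : MvPolynomial σ ℝ) :
    (aeval g p).totalDegree ≤ p.totalDegree := by
  rw [aeval_def, eval₂_eq]
  refine totalDegree_finsetSum_le fun s hs => (totalDegree_mul _ _).trans ?_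
  rw [algebraMap_eq, totalDegree_C, zero_add]
  exact (totalDegree_prod_pow_le _ _ hg _).trans (le_totalDegree hs)

theorem sum_atPoint_mem_extendable {n D d : ℕ} (q : MvPolynomial (Fin n ⊕ Fin n) ℝ)
    (hq : q.totalDegree ≤ d) : ∑ i, atPoint i q ∈ extendable n D d := by
  -- The inverse change of variables `x = (ξ - η)/2`, `y = (ξ + η)/2`, with `η` in the left and `ξ`
  -- in the right slot.
  let g : Fin n ⊕ Fin n → MvPolynomial (Fin n ⊕ Fin n) ℝ := Sum.elim
    (fun j => C (1 / 2 : ℝ) * (X (Sum.inr j) - X (Sum.inl j)))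
    (fun j => C (1 / 2 : ℝ) * (X (Sum.inr j) + X (Sum.inl j)))
  have hg : ∀ s, (g s).totalDegree ≤ 1 := by
    rintro (j | j)
    · exact (totalDegree_mul _ _).trans
        (by rw [totalDegree_C, zero_add]; exact (totalDegree_sub _ _).trans (by simp))
    · exact (totalDegree_mul _ _).trans
        (by rw [totalDegree_C, zero_add]; exact (totalDegree_add _ _).trans (by simp))
  have hcov : ∀ i : Fin D, atPoint i q =
      aeval (Sum.elim (eta i) (xi i) : Fin n ⊕ Fin n → CoordRing n D) (aeval g q) := fun i => by
    rw [comp_aeval_apply, atPoint, rename_eq_aeval]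
    congr 2
    have h2 : (C (1 / 2 : ℝ) : CoordRing n D) * 2 = 1 := by
      rw [← map_ofNat C 2, ← C_mul]; norm_num
    funext s
    rcases s with j | j
    · simp only [g, Sum.elim_inl, map_mul, map_sub, aeval_X, Sum.elim_inr, algHom_C, eta, xi,
        algebraMap_eq, Function.comp]
      linear_combination (-X (i, Sum.inl j)) * h2
    · simp only [g, Sum.elim_inl, map_mul, map_add, aeval_X, Sum.elim_inr, algHom_C, eta, xi,
        algebraMap_eq, Function.comp]
      linear_combination (-X (i, Sum.inr j)) * h2
  have hsum : ∑ i, atPoint i q = ∑ s ∈ (aeval g q).support, coeff s (aeval g q) •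
      powerSum (fun j => s (Sum.inl j)) (fun j => s (Sum.inr j)) D := by
    simp only [hcov, powerSum, Finset.smul_sum]
    rw [Finset.sum_comm]
    refine Finset.sum_congr rfl fun i _ => ?_
    rw [aeval_def, eval₂_eq']
    refine Finset.sum_congr rfl fun s _ => ?_
    rw [Algebra.smul_def, Fintype.prod_sum_type]
    rfl
  rw [hsum]
  refine sum_mem fun s hs => Submodule.smul_mem _ _
    (extendable_mono ?_ (powerSum_mem_extendable _ _))
  have := ((le_totalDegree hs).trans (totalDegree_aeval_le g hg q)).trans hq
  rwa [Finsupp.sum_fintype _ _ (by simp), Fintype.sum_sum_type] at this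

/-- Let the point of index `0` range freely, then subtract its coincidences with each other point
`l`; a coincidence merges two factors into one. -/
theorem sum_embedding_succ {R : Type*} [CommRing R] {D k : ℕ} (g : Fin (k + 1) → Fin D → R) :
    ∑ e : Fin (k + 1) ↪ Fin D, ∏ i, g i (e i) =
      (∑ x, g 0 x) * (∑ e : Fin k ↪ Fin D, ∏ i, g i.succ (e i)) -
        ∑ l, ∑ e : Fin k ↪ Fin D,
          ∏ i, (if i = l then g 0 (e i) * g i.succ (e i) else g i.succ (e i)) := by
  classical
  rw [← (Equiv.embeddingFinSucc k (Fin D)).symm.sum_comp, Fintype.sum_sigma, Finset.sum_comm,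
    Finset.mul_sum, ← Finset.sum_sub_distrib]
  refine Finset.sum_congr rfl fun e _ => ?_
  have h1 : ∀ l, ∏ i, (if i = l then g 0 (e i) * g i.succ (e i) else g i.succ (e i)) =
      g 0 (e l) * ∏ i, g i.succ (e i) := fun l => by
    have h2 : ∀ i, (if i = l then g 0 (e i) * g i.succ (e i) else g i.succ (e i)) =
        (if i = l then g 0 (e i) else 1) * g i.succ (e i) := fun i => by
      split_ifs <;> simp
    simp only [h2, Finset.prod_mul_distrib, Finset.prod_ite_eq', Finset.mem_univ, if_true]
  simp only [Equiv.coe_embeddingFinSucc_symm, Fin.prod_univ_succ, Fin.cons_zero, Fin.cons_succ, h1]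
  rw [← Finset.sum_mul, ← Finset.sum_mul, ← sub_mul]
  congr 1
  rw [eq_sub_iff_add_eq, ← Fintype.sum_subtype_add_sum_subtype (fun x => x ∉ Set.range e) (g 0)]
  congr 1
  exact Fintype.sum_equiv ((Equiv.ofInjective e e.injective).trans
    (Equiv.subtypeEquivRight (by simp))) _ _ fun x => rfl

/-- Induction on the number of factors: the recursion above leaves shorter sums, and merging two
factors preserves the total degree bound. -/
theorem sum_embedding_mem_extendable {n D : ℕ} (k : ℕ)
    (q : Fin k → MvPolynomial (Fin n ⊕ Fin n) ℝ) (d : Fin k → ℕ)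
    (hq : ∀ i, (q i).totalDegree ≤ d i) :
    ∑ e : Fin k ↪ Fin D, ∏ i, atPoint (e i) (q i) ∈ extendable n D (∑ i, d i) := by
  induction k with
  | zero => simpa using one_mem_extendable n D
  | succ k ih =>
    rw [sum_embedding_succ fun i x => atPoint x (q i), Fin.sum_univ_succ]
    refine sub_mem (mul_mem_extendable (sum_atPoint_mem_extendable _ (hq 0))
      (ih _ _ fun i => hq i.succ)) (sum_mem fun l _ => ?_)
    have h := ih (fun i => if i = l then q 0 * q i.succ else q i.succ)
      (fun i => if i = l then d 0 + d i.succ else d i.succ) fun i => by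
        split_ifs
        · exact (totalDegree_mul _ _).trans (Nat.add_le_add (hq 0) (hq i.succ))
        · exact hq i.succ
    have hd : ∑ i : Fin k, (if i = l then d 0 + d i.succ else d i.succ) =
        d 0 + ∑ i : Fin k, d i.succ := by
      have h2 : ∀ i : Fin k, (if i = l then d 0 + d i.succ else d i.succ) =
          (if i = l then d 0 else 0) + d i.succ := fun i => by split_ifs <;> simp
      simp [h2, Finset.sum_add_distrib]
    rw [hd] at h
    convert h using 5
    split_ifs <;> simp

theorem sum_permAct_monomial_mem_extendable {n D : ℕ} (s : Fin D × (Fin n ⊕ Fin n) →₀ ℕ) :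
    ∑ σ : Equiv.Perm (Fin D), permAct σ (monomial s (1 : ℝ)) ∈
      extendable n D (s.sum fun _ e => e) := by
  -- Embeddings of `Fin D` into itself are the permutations, so this sum is the orbit sum of the
  -- monomial.
  have h := sum_embedding_mem_extendable (D := D) D
    (fun i => ∏ v : Fin n ⊕ Fin n, X v ^ s (i, v)) (fun i => ∑ v, s (i, v))
    (fun i => totalDegree_prod_pow_le _ _ (fun v => (totalDegree_X v).le) _)
  rw [← Fintype.sum_prod_type', ← Finsupp.sum_fintype s (fun _ e => e) (by simp)] at h
  convert h using 1
  refine Fintype.sum_equiv (Equiv.embeddingEquivOfFinite (Fin D)).symm _ _ fun σ => ?_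
  have hs : (monomial s (1 : ℝ) : CoordRing n D) =
      ∏ i, atPoint i (∏ v : Fin n ⊕ Fin n, X v ^ s (i, v)) := by
    rw [monomial_eq, C_1, one_mul, Finsupp.prod_fintype _ _ (by simp), Fintype.prod_prod_type]
    simp [atPoint]
  rw [hs, map_prod]
  refine Finset.prod_congr rfl fun i _ => ?_
  rw [permAct_atPoint]
  rfl

theorem mem_extendable_of_mem_symRing {n D d : ℕ} {f : CoordRing n D} (hf : f ∈ symRing n D)
    (hd : f.totalDegree ≤ d) : f ∈ extendable n D d := by
  -- An invariant equals its average over the symmetric group.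
  have h : f = (Nat.factorial D : ℝ)⁻¹ • ∑ s ∈ f.support, coeff s f •
      ∑ σ : Equiv.Perm (Fin D), permAct σ (monomial s (1 : ℝ)) := by
    have h2 : ∑ s ∈ f.support, coeff s f •
        ∑ σ : Equiv.Perm (Fin D), permAct σ (monomial s (1 : ℝ)) =
        ∑ σ : Equiv.Perm (Fin D), permAct σ f := by
      simp only [Finset.smul_sum]
      rw [Finset.sum_comm]
      refine Finset.sum_congr rfl fun σ _ => ?_
      conv_rhs => rw [as_sum f, map_sum]
      refine Finset.sum_congr rfl fun s _ => ?_
      rw [← map_smul, smul_monomial, smul_eq_mul, mul_one]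
    rw [h2, Finset.sum_congr rfl fun σ _ => hf σ, Finset.sum_const, Finset.card_univ,
      Fintype.card_perm, Fintype.card_fin, ← Nat.cast_smul_eq_nsmul ℝ, smul_smul,
      inv_mul_cancel₀ (Nat.cast_ne_zero.2 (Nat.factorial_ne_zero D)), one_smul]
  rw [h]
  exact Submodule.smul_mem _ _ (sum_mem fun s hs => Submodule.smul_mem _ _
    (extendable_mono ((le_totalDegree hs).trans hd) (sum_permAct_monomial_mem_extendable s)))

theorem coeff_restrict {n m : ℕ} (g : CoordRing n (m + 1)) (s : Fin m × (Fin n ⊕ Fin n) →₀ ℕ) :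
    coeff s (restrict n m g) = coeff (s.mapDomain (Prod.map Fin.castSucc id)) g := by
  have hinj : Function.Injective (Prod.map Fin.castSucc id :
      Fin m × (Fin n ⊕ Fin n) → Fin (m + 1) × (Fin n ⊕ Fin n)) :=
    (Fin.castSucc_injective m).prodMap Function.injective_id
  rw [← coeff_killCompl hinj]
  suffices h : restrict n m = killCompl hinj by rw [h]
  ext1 ⟨i, v⟩
  refine Fin.lastCases ?_ (fun i => ?_) i
  · simp [restrict, killCompl]
  · have h : (X (i.castSucc, v) : CoordRing n (m + 1)) =
      rename (Prod.map Fin.castSucc id) (X (i, v)) := by simp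
    rw [h, killCompl_rename_app]
    simp [restrict]

/-- A monomial of degree at most `m` misses one of the `m + 1` points. Symmetry moves that point to
the last place, where restriction preserves the coefficient. -/
theorem eq_zero_of_restrict_eq_zero {n m : ℕ} {g : CoordRing n (m + 1)}
    (hg : g ∈ symRing n (m + 1)) (hd : g.totalDegree ≤ m) (h : restrict n m g = 0) : g = 0 := by
  ext s
  rw [coeff_zero]
  by_contra hs
  have hle := (le_totalDegree (mem_support_iff.2 hs)).trans hd
  rw [Finsupp.sum_fintype _ _ (by simp), Fintype.sum_prod_type] at hle
  obtain ⟨i, hi⟩ : ∃ i, ∑ v, s (i, v) = 0 := by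
    by_contra! hne
    have := Finset.card_nsmul_le_sum Finset.univ (fun i => ∑ v, s (i, v)) 1
      fun i _ => Nat.one_le_iff_ne_zero.2 (hne i)
    simp only [Finset.card_univ, Fintype.card_fin, smul_eq_mul, mul_one] at this
    omega
  let σ := Equiv.swap i (Fin.last m)
  have hinj : Function.Injective (Prod.map σ id :
      Fin (m + 1) × (Fin n ⊕ Fin n) → Fin (m + 1) × (Fin n ⊕ Fin n)) :=
    σ.injective.prodMap Function.injective_id
  have hc : coeff (s.mapDomain (Prod.map σ id)) g = coeff s g := by
    conv_lhs => rw [← hg σ]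
    exact coeff_rename_mapDomain _ hinj _ _
  have hinj' : Function.Injective (Prod.map Fin.castSucc id :
      Fin m × (Fin n ⊕ Fin n) → Fin (m + 1) × (Fin n ⊕ Fin n)) :=
    (Fin.castSucc_injective m).prodMap Function.injective_id
  have hsub : ((s.mapDomain (Prod.map σ id)).support : Set _) ⊆
      Set.range (Prod.map Fin.castSucc id :
        Fin m × (Fin n ⊕ Fin n) → Fin (m + 1) × (Fin n ⊕ Fin n)) := by
    rintro ⟨x, v⟩ hx
    have hlast : x ≠ Fin.last m := by
      rintro rfl
      have : (Fin.last m, v) = Prod.map σ id (i, v) := by simp [σ]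
      rw [this, Finset.mem_coe, Finsupp.mem_support_iff, Finsupp.mapDomain_apply hinj] at hx
      exact hx (Finset.sum_eq_zero_iff.1 hi v (Finset.mem_univ v))
    exact ⟨(x.castPred hlast, v), by simp⟩
  rw [← Finsupp.mapDomain_comapDomain _ hinj' _ hsub, ← coeff_restrict, h, coeff_zero] at hc
  exact hs hc.symm

/-- Below `D` compatibility suffices; above `D` restriction is injective on symmetric polynomials of
degree at most `D`. -/
theorem eq_zero_of_apply_eq_zero {n D : ℕ} {f : ∀ m, CoordRing n m} (hf : f ∈ limRing n)
    (hd : ∀ m, (f m).totalDegree ≤ D) (h : f D = 0) : f = 0 := by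
  funext m
  rcases le_total m D with hm | hm
  · induction hm using Nat.decreasingInduction with
    | self => exact h
    | of_succ k _ ih => rw [← hf.2 k, ih]; exact map_zero _
  · induction m, hm using Nat.le_induction with
    | base => exact h
    | succ k hk ih =>
      refine eq_zero_of_restrict_eq_zero (hf.1 _) ((hd _).trans hk) ?_
      rw [hf.2, ih]
      rfl

/-- The power sums generate the ring of functions on the infinite symmetric product. -/
theorem powerSumRing_eq_finRing (n : ℕ) : powerSumRing n = finRing n := by
  refine le_antisymm (powerSumRing_le_finRing n) ?_
  rintro f ⟨hf, D, hD⟩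
  obtain ⟨F, hF, hFD, hFd⟩ := mem_extendable_of_mem_symRing (hf.1 D) (hD D)
  have h : f - F = 0 := eq_zero_of_apply_eq_zero (sub_mem hf (powerSumRing_le_finRing n hF).1)
    (fun m => (totalDegree_sub _ _).trans (max_le (hD m) (hFd m))) (by simp [hFD])
  rw [sub_eq_zero.1 h]
  exact hF

/-! ### Values of power sums and algebraic independence -/

/-- The coordinates `η = 𝐲 - 𝐱` and `ξ = 𝐲 + 𝐱` of a point `(𝐱, 𝐲)`. -/
def etaXi {n : ℕ} (z : Cube n) : Fin n ⊕ Fin n → ℝ := Sum.elim (z.2 - z.1) (z.2 + z.1)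

theorem etaXi_surjective (n : ℕ) : Function.Surjective (etaXi (n := n)) := fun t => by
  refine ⟨(fun j => (t (Sum.inr j) - t (Sum.inl j)) / 2,
    fun j => (t (Sum.inr j) + t (Sum.inl j)) / 2), ?_⟩
  funext s
  rcases s with j | j <;> simp [etaXi] <;> ring

theorem isDegenerate_iff {n : ℕ} (z : Cube n) :
    z.IsDegenerate ↔ ∃ j, etaXi z (Sum.inl j) = 0 :=
  exists_congr fun _ => eq_comm.trans sub_eq_zero.symm

theorem coords_surjective (n m : ℕ) : Function.Surjective (coords (n := n) (m := m)) := fun x => by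
  refine ⟨fun i => (fun j => x (i, Sum.inl j), fun j => x (i, Sum.inr j)), ?_⟩
  funext ⟨i, v⟩
  cases v <;> rfl

/-- The exponents of the variables `η` and `ξ` as one function. -/
def exponents {n : ℕ} (c : (Fin n → ℕ) × (Fin n → ℕ)) : Fin n ⊕ Fin n → ℕ := Sum.elim c.1 c.2

theorem exponents_injective (n : ℕ) : Function.Injective (exponents (n := n)) := fun _ _ h =>
  Prod.ext (funext fun j => congrFun h (Sum.inl j)) (funext fun j => congrFun h (Sum.inr j))

theorem eval_powerSum {n m : ℕ} {ι : Type*} (c : ι → (Fin n → ℕ) × (Fin n → ℕ)) (i : ι)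
    (P : Fin m → Cube n) : eval (coords P) (powerSum (c i).1 (c i).2 m) =
      (∑ l, monomialVector (exponents ∘ c) (etaXi (P l))) i := by
  simp [powerSum, monomialVector, Finset.sum_apply, Fintype.prod_sum_type, exponents, etaXi, eta,
    xi, coords]

theorem eval_aeval_apply {n m : ℕ} {ι : Type*} (g : ι → ∀ m, CoordRing n m)
    (F : MvPolynomial ι ℝ) (x : Fin m × (Fin n ⊕ Fin n) → ℝ) :
    eval x (aeval g F m) = eval (fun i => eval x (g i m)) F := by
  have h := comp_aeval_apply (f := g)
    ((aeval x : CoordRing n m →ₐ[ℝ] ℝ).comp (Pi.evalAlgHom ℝ (CoordRing n) m)) F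
  exact h

theorem eval_aeval_powerSum {n m : ℕ} {ι : Type*} (c : ι → (Fin n → ℕ) × (Fin n → ℕ))
    (F : MvPolynomial ι ℝ) (P : Fin m → Cube n) :
    eval (coords P) (aeval (fun i => powerSum (c i).1 (c i).2) F m) =
      eval (∑ l, monomialVector (exponents ∘ c) (etaXi (P l))) F := by
  rw [eval_aeval_apply]
  congr 2
  exact funext fun i => eval_powerSum c i P

theorem exists_tuple_of_mem_closure {n : ℕ} {ι : Type*} (c : ι → (Fin n → ℕ) × (Fin n → ℕ))
    {u : ι → ℝ} (hu : u ∈ AddSubmonoid.closure (monomialVector (exponents ∘ c) '' Set.univ)) :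
    ∃ (m : ℕ) (P : Fin m → Cube n), ∑ l, monomialVector (exponents ∘ c) (etaXi (P l)) = u := by
  induction hu using AddSubmonoid.closure_induction with
  | mem u hu =>
    obtain ⟨t, -, rfl⟩ := hu
    obtain ⟨z, rfl⟩ := etaXi_surjective n t
    exact ⟨1, fun _ => z, by simp⟩
  | zero => exact ⟨0, Fin.elim0, by simp⟩
  | add u v _ _ hu hv =>
    obtain ⟨m, P, rfl⟩ := hu
    obtain ⟨k, Q, rfl⟩ := hv
    exact ⟨m + k, Fin.append P Q, by simp [Fin.sum_univ_add]⟩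

/-- Power sums with distinct exponents are algebraically independent. -/
theorem algebraicIndependent_powerSum {n : ℕ} {ι : Type*}
    {c : ι → (Fin n → ℕ) × (Fin n → ℕ)} (hc : Function.Injective c) :
    AlgebraicIndependent ℝ (fun i => powerSum (c i).1 (c i).2) := by
  refine algebraicIndependent_iff.2 fun F hF => MvPolynomial.funext fun u => ?_
  rw [map_zero]
  refine eval_eq_zero_of_monomialVector (Z := Set.univ) ((exponents_injective n).comp hc)
    (fun v hv => ?_) fun i _ => ⟨∅, by simp, by simp⟩
  obtain ⟨m, P, rfl⟩ := exists_tuple_of_mem_closure c hv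
  rw [← eval_aeval_powerSum, hF, Pi.zero_apply, map_zero]

/-! ### Invariance under adding cubes of volume zero -/

/-- Invariance need only be tested on one dropped cube: `f` then descends to `SpTilde n`, and
evaluation factors through it. -/
theorem mem_finTildeRing_iff {n : ℕ} [NeZero n] {f : ∀ m, CoordRing n m} :
    f ∈ finTildeRing n ↔ f ∈ finRing n ∧ ∀ (m : ℕ) (P : Fin m → Cube n) (z : Cube n),
      z.IsDegenerate → eval (coords (Fin.snoc P z : Fin (m + 1) → Cube n)) (f (m + 1)) =
        eval (coords P) (f m) := by
  constructor
  · rintro ⟨hf, h⟩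
    exact ⟨hf, fun m P z hz => h (Quot.mk _ ⟨m + 1, Fin.snoc P z⟩) (Quot.mk _ ⟨m, P⟩)
      (Quot.sound (SpTildeRel.drop m P z hz))⟩
  · rintro ⟨hf, h⟩
    let g : SpTilde n → ℝ := Quot.lift (fun P => eval (coords P.2) (f P.1)) (by
      rintro _ _ (⟨m, P, σ⟩ | ⟨m, P, z, hz⟩)
      · exact ((eval_coords_perm P σ _).trans (by rw [hf.1.1 m σ])).symm
      · exact h m P z hz)
    have hg : ∀ X : SpInf n, evalAt X ⟨f, hf.1⟩ = g X.toTilde := fun X => by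
      induction X using Quot.ind
      rfl
    exact ⟨hf, fun X₁ X₂ e => by rw [hg, hg, e]⟩

theorem ne_zero_of_one_le {n : ℕ} [NeZero n] {c : (Fin n → ℕ) × (Fin n → ℕ)}
    (hc : ∀ j, 1 ≤ c.1 j) : c ≠ 0 := by
  rintro rfl
  exact absurd (hc 0) (by simp)

theorem powerSum_mem_finTildeRing {n : ℕ} [NeZero n] {c : (Fin n → ℕ) × (Fin n → ℕ)}
    (hc : ∀ j, 1 ≤ c.1 j) : powerSum c.1 c.2 ∈ finTildeRing n := by
  refine mem_finTildeRing_iff.2 ⟨powerSum_mem_finRing (ne_zero_of_one_le hc), fun m P z hz => ?_⟩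
  obtain ⟨k, hk⟩ := (isDegenerate_iff z).1 hz
  rw [eval_powerSum (fun _ : Unit => c) (), eval_powerSum (fun _ : Unit => c) (),
    Fin.sum_univ_castSucc, Pi.add_apply]
  simp only [Fin.snoc_castSucc, Fin.snoc_last, add_eq_left]
  refine Finset.prod_eq_zero (Finset.mem_univ (Sum.inl k)) ?_
  rw [hk]
  exact zero_pow (Nat.one_le_iff_ne_zero.1 (hc k))

/-- Appending degenerate cubes to `P` one at a time realises the translation by `u` without changing
the value of `f`. -/
theorem exists_tuple_add_of_mem_closure {n : ℕ} [NeZero n] {ι : Type*}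
    (c : ι → (Fin n → ℕ) × (Fin n → ℕ)) {f : ∀ m, CoordRing n m} (hf : f ∈ finTildeRing n)
    {u : ι → ℝ} (hu : u ∈ AddSubmonoid.closure
      (monomialVector (exponents ∘ c) '' {t | ∃ j, t (Sum.inl j) = 0}))
    (m : ℕ) (P : Fin m → Cube n) :
    ∃ (k : ℕ) (Q : Fin k → Cube n), ∑ l, monomialVector (exponents ∘ c) (etaXi (Q l)) =
      ∑ l, monomialVector (exponents ∘ c) (etaXi (P l)) + u ∧
        eval (coords Q) (f k) = eval (coords P) (f m) := by
  induction hu using AddSubmonoid.closure_induction generalizing m P with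
  | mem u hu =>
    obtain ⟨t, ht, rfl⟩ := hu
    obtain ⟨z, rfl⟩ := etaXi_surjective n t
    exact ⟨m + 1, Fin.snoc P z, by simp [Fin.sum_univ_castSucc],
      (mem_finTildeRing_iff.1 hf).2 m P z ((isDegenerate_iff z).2 ht)⟩
  | zero => exact ⟨m, P, by simp, rfl⟩
  | add u v _ _ hu hv =>
    obtain ⟨k, Q, hQ, hQf⟩ := hu m P
    obtain ⟨k', Q', hQ', hQf'⟩ := hv k Q
    exact ⟨k', Q', by rw [hQ', hQ, add_assoc], hQf'.trans hQf⟩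

theorem eval_aeval_C_add_X {ι : Type*} (F : MvPolynomial ι ℝ) (w u : ι → ℝ) :
    eval u (aeval (fun i => C (w i) + X i) F : MvPolynomial ι ℝ) = eval (w + u) F := by
  rw [← aeval_eq_eval, ← aeval_eq_eval, comp_aeval_apply]
  congr 2
  funext i
  simp

/-- In a polynomial in the power sums that is invariant under adding cubes of volume zero, the
power sums that involve not all of the `η_j` may be replaced by zero. -/
theorem aeval_powerSum_eq_of_mem_finTildeRing {n : ℕ} [NeZero n] {ι : Type*}
    {c : ι → (Fin n → ℕ) × (Fin n → ℕ)} (hc : Function.Injective c)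
    [DecidablePred fun i => ∀ j, 1 ≤ (c i).1 j] (F : MvPolynomial ι ℝ)
    (hF : aeval (fun i => powerSum (c i).1 (c i).2) F ∈ finTildeRing n) :
    aeval (fun i => powerSum (c i).1 (c i).2) F =
      aeval (fun i => if ∀ j, 1 ≤ (c i).1 j then powerSum (c i).1 (c i).2 else 0) F := by
  funext m
  refine MvPolynomial.funext fun x => ?_
  obtain ⟨P, rfl⟩ := coords_surjective n m x
  let w := ∑ l, monomialVector (exponents ∘ c) (etaXi (P l))
  -- The translation that cancels the unwanted coordinates of `w`. Each monomial in its support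
  -- omits some `η_j`, so the hyperplane `η_j = 0` of degenerate cubes serves as the coordinate
  -- subspace.
  let u : ι → ℝ := fun i => if ∀ j, 1 ≤ (c i).1 j then 0 else -w i
  have h : eval u (aeval (fun i => C (w i) + X i) F - C (eval w F) : MvPolynomial ι ℝ) = 0 := by
    refine eval_eq_zero_of_monomialVector (Z := {t | ∃ j, t (Sum.inl j) = 0})
      ((exponents_injective n).comp hc) (fun v hv => ?_) fun i hi => ?_
    · obtain ⟨k, Q, hQ, hQf⟩ := exists_tuple_add_of_mem_closure c hF hv m P
      rw [eval_aeval_powerSum, eval_aeval_powerSum, hQ] at hQf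
      rw [map_sub, eval_aeval_C_add_X, eval_C, hQf, sub_self]
    · have hi' : ¬ ∀ j, 1 ≤ (c i).1 j := fun h => hi (if_pos h)
      push Not at hi'
      obtain ⟨j, hj⟩ := hi'
      refine ⟨{Sum.inl j}, ?_, fun t ht => ⟨j, ht _ rfl⟩⟩
      rintro _ rfl
      exact Nat.lt_one_iff.1 hj
  rw [map_sub, eval_aeval_C_add_X, eval_C, sub_eq_zero] at h
  rw [eval_aeval_powerSum, eval_aeval_apply]
  refine h.symm.trans ?_
  congr 2
  funext i
  by_cases hi : ∀ j, 1 ≤ (c i).1 j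
  · simp only [u, Pi.add_apply, if_pos hi, add_zero]
    exact (eval_powerSum c i P).symm
  · simp [u, if_neg hi]

theorem finTildeRing_le_adjoin (n : ℕ) [NeZero n] :
    finTildeRing n ≤ Algebra.adjoin ℝ
      (Set.range fun c : {c : (Fin n → ℕ) × (Fin n → ℕ) // ∀ j, 1 ≤ c.1 j} =>
        powerSum c.1.1 c.1.2) := by
  classical
  intro f hf
  have hf' := (mem_finTildeRing_iff.1 hf).1
  rw [← powerSumRing_eq_finRing, powerSumRing, Algebra.adjoin_range_eq_range_aeval] at hf'
  obtain ⟨F, rfl⟩ := hf'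
  have h := aeval_powerSum_eq_of_mem_finTildeRing
    (c := fun c : {c : (Fin n → ℕ) × (Fin n → ℕ) // c ≠ 0} => c.1) Subtype.val_injective F hf
  have hmem := (aeval fun c : {c : (Fin n → ℕ) × (Fin n → ℕ) // c ≠ 0} =>
    if ∀ j, 1 ≤ c.1.1 j then powerSum c.1.1 c.1.2 else 0).mem_range_self F
  rw [← h, ← Algebra.adjoin_range_eq_range_aeval] at hmem
  refine Algebra.adjoin_le ?_ hmem
  rintro _ ⟨c, rfl⟩
  dsimp only
  split_ifs with hc
  · exact Algebra.subset_adjoin ⟨⟨c.1, hc⟩, rfl⟩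
  · exact zero_mem _

end

end PersistentCubes

/-- For `n ≥ 1`, the `ℝ`-algebra `A_fin[S̃p]` is freely generated by the power sums `p_{𝐚,𝐛}` with
`a_j ≥ 1` for all `j`: they are algebraically independent and generate it. -/
theorem mainTheorem1 (n : ℕ) [NeZero n] :
    AlgebraicIndependent ℝ
        (fun c : {c : (Fin n → ℕ) × (Fin n → ℕ) // ∀ j, 1 ≤ c.1 j} =>
          PersistentCubes.powerSum c.1.1 c.1.2) ∧
      Algebra.adjoin ℝ
          (Set.range fun c : {c : (Fin n → ℕ) × (Fin n → ℕ) // ∀ j, 1 ≤ c.1 j} =>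
            PersistentCubes.powerSum c.1.1 c.1.2) =
        PersistentCubes.finTildeRing n := by
  refine ⟨PersistentCubes.algebraicIndependent_powerSum Subtype.val_injective,
    le_antisymm (Algebra.adjoin_le ?_) (PersistentCubes.finTildeRing_le_adjoin n)⟩
  rintro _ ⟨c, rfl⟩
  exact PersistentCubes.powerSum_mem_finTildeRing c.2
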